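/- Let $S^2$ be the unit sphere in $\mathbb{R}^3$ with the geodesic (great-circle) distance $d$, the central angle between two points. For a finite set $S\subset S^2$ and a vantage point $V\in S^2$ whose distances $d(V,P)$, $P\in S$, are pairwise distinct, $V$ generates an ordering of $S$: $P$ precedes $Q$ precisely when $d(V,P)<d(V,Q)$. (Vantage points that produce ties are ignored.) Let $a(S)$ be the number of distinct orderings of $S$ generated as $V$ moves over $S^2$. For every integer $n>1$, the maximum of $a(S)$ over all sets $S$ of $n$ distinct points of $S^2$ is attained and equals $$\frac{1}{12}\left(3n^4-10n^3+9n^2-2n+24\right).$$ -/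

import Mathlib

/-- The unit sphere `S²` in three-dimensional Euclidean space. -/
abbrev Sphere2 : Type := Metric.sphere (0 : EuclideanSpace ℝ (Fin 3)) 1

/-- The geodesic (great-circle) distance on the unit sphere: the length of a shortest great-circle
arc from `p` to `q`, that is, the central angle (in `[0, π]`) between `p` and `q`. -/
noncomputable def geodesicDist (p q : Sphere2) : ℝ :=
  InnerProductGeometry.angle (p : EuclideanSpace ℝ (Fin 3)) (q : EuclideanSpace ℝ (Fin 3))

/-- The vantage point `V` sees no ties among the points of `S`. -/
def TieFree (S : Finset Sphere2) (V : Sphere2) : Prop :=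
  ∀ p ∈ S, ∀ q ∈ S, p ≠ q → geodesicDist V p ≠ geodesicDist V q

/-- The order relation on the points of `S` seen from `V`: `p` comes before `q` precisely when
`p` is strictly closer to `V` than `q`. -/
def vantageOrder (S : Finset Sphere2) (V : Sphere2) : S → S → Prop :=
  fun p q => geodesicDist V p < geodesicDist V q

/-- The set of orderings of `S` generated as the vantage point `V` moves over the sphere
(vantage points that produce ties are ignored). -/
def orderings (S : Finset Sphere2) : Set (S → S → Prop) :=
  {r | ∃ V : Sphere2, TieFree S V ∧ vantageOrder S V = r}

/-- The number of distinct orderings of `S` generated by vantage points on the sphere. -/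
noncomputable def numOrderings (S : Finset Sphere2) : ℕ :=
  (orderings S).ncard

/-- There are finitely many orderings, so that `numOrderings` is a genuine count. -/
theorem orderings_finite (S : Finset Sphere2) : (orderings S).Finite :=
  Set.toFinite _

/-- The orderings that are counted are strict total orders on `S`. -/
theorem isStrictTotalOrder_of_mem_orderings (S : Finset Sphere2) (r : S → S → Prop)
    (hr : r ∈ orderings S) : IsStrictTotalOrder S r := by
  obtain ⟨V, hV, rfl⟩ := hr
  exact
    { trichotomous := fun p q h1 h2 => by
        by_contra hpq
        exact hV p p.2 q q.2 (fun h => hpq (Subtype.ext h))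
          (le_antisymm (not_lt.mp h2) (not_lt.mp h1))
      irrefl := fun p => lt_irrefl (geodesicDist V p)
      trans := fun p q s h1 h2 => lt_trans (α := ℝ) h1 h2 }

/-! Since `arccos` is decreasing, `P` precedes `Q` from `V` exactly when `⟪P - Q, V⟫ > 0`. So
orderings are the cells of the central arrangement of bisector planes `(P i - P j)ᗮ` in `ℝ³`,
counted by deletion and restriction (`ncard_signPatterns_insert`).

Add a point `P b` to `b` old ones. On the bisector of `P a` and `P b` every other comparison with `P
b` agrees up to sign with one between old points (`ncard_signPatterns_on_bisector`), so at most
`b(b-1)/2` lines cut this plane, into at most `b(b-1)` sectors. Hence `r(b+1) ≤ r(b) + b · b(b-1)`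
with `r(2) = 2`, and the quartic solves the recurrence with equality.

Equality holds when on each new bisector these lines are genuine and distinct, which `GenericUpTo`
ensures. Generic points are chosen one by one on a spherical curve that meets each plane finitely
often. -/

/-- The sign patterns of the functionals `f i`, `i ∈ I`, at the points of `W` where none of them
vanishes; a pattern is recorded as the set of indices with positive value. -/
def signPatterns {ι E : Type*} [AddCommGroup E] [Module ℝ E] (f : ι → E →ₗ[ℝ] ℝ)
    (W : Submodule ℝ E) (I : Finset ι) : Set (Finset ι) :=
  (fun V => {i ∈ I | 0 < f i V}) '' {V | V ∈ W ∧ ∀ i ∈ I, f i V ≠ 0}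

theorem ncard_image_eq_ncard_image {α β γ : Type*} {s : Set α} {F : α → β} {G : α → γ}
    (h : ∀ x ∈ s, ∀ y ∈ s, F x = F y ↔ G x = G y) : (F '' s).ncard = (G '' s).ncard := by
  refine Set.ncard_congr (fun b hb => G hb.choose) ?_ ?_ ?_
  · intro b hb
    exact ⟨_, hb.choose_spec.1, rfl⟩
  · intro b c hb hc hbc
    rw [← hb.choose_spec.2, ← hc.choose_spec.2]
    exact (h _ hb.choose_spec.1 _ hc.choose_spec.1).2 hbc
  · rintro _ ⟨x, hx, rfl⟩
    have hb : F x ∈ F '' s := ⟨x, hx, rfl⟩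
    exact ⟨F x, hb, (h _ hb.choose_spec.1 _ hx).1 hb.choose_spec.2⟩

/-! ### Cells of a central arrangement: deletion, restriction, and counts in dimensions 1 and 2. -/

section SignPatterns

variable {ι E : Type*} [AddCommGroup E] [Module ℝ E] {f : ι → E →ₗ[ℝ] ℝ}
  {W : Submodule ℝ E} {I J : Finset ι}

theorem filter_pos_eq_iff {V V' : E} :
    ({i ∈ I | 0 < f i V} : Finset ι) = {i ∈ I | 0 < f i V'} ↔
      ∀ i ∈ I, (0 < f i V ↔ 0 < f i V') := by
  rw [Finset.filter_inj']

theorem signPatterns_subset_powerset : signPatterns f W I ⊆ ↑I.powerset := by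
  rintro _ ⟨V, -, rfl⟩
  exact Finset.mem_coe.2 (Finset.mem_powerset.2 (Finset.filter_subset _ _))

theorem signPatterns_finite : (signPatterns f W I).Finite :=
  (Finset.finite_toSet _).subset signPatterns_subset_powerset

theorem ncard_signPatterns_empty : (signPatterns f W ∅).ncard = 1 := by
  rw [Set.ncard_eq_one]
  refine ⟨∅, Set.eq_singleton_iff_unique_mem.2 ⟨⟨0, by simp, by simp⟩, ?_⟩⟩
  rintro _ ⟨V, -, rfl⟩
  simp

theorem signPatterns_eq_empty {i : ι} (hi : i ∈ I) (h : ∀ V ∈ W, f i V = 0) :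
    signPatterns f W I = ∅ := by
  rw [signPatterns, Set.image_eq_empty, Set.eq_empty_iff_forall_notMem]
  rintro V ⟨hV, hV'⟩
  exact hV' i hi (h V hV)

/-- Functionals proportional to others on `W` do not change the number of sign patterns. -/
theorem ncard_signPatterns_eq_of_proportional (hIJ : I ⊆ J)
    (h : ∀ j ∈ J, ∃ k ∈ I, ∃ c : ℝ, c ≠ 0 ∧ ∀ V ∈ W, f j V = c * f k V) :
    (signPatterns f W J).ncard = (signPatterns f W I).ncard := by
  have hdom : {V | V ∈ W ∧ ∀ i ∈ J, f i V ≠ 0} = {V | V ∈ W ∧ ∀ i ∈ I, f i V ≠ 0} := by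
    ext V
    refine and_congr_right fun hV => ⟨fun h' i hi => h' i (hIJ hi), fun h' j hj => ?_⟩
    obtain ⟨k, hk, c, hc, hcV⟩ := h j hj
    rw [hcV V hV]
    exact mul_ne_zero hc (h' k hk)
  rw [signPatterns, signPatterns, hdom]
  refine ncard_image_eq_ncard_image ?_
  rintro V ⟨hV, hVI⟩ V' ⟨hV', hVI'⟩
  simp only [filter_pos_eq_iff]
  refine ⟨fun h' i hi => h' i (hIJ hi), fun h' j hj => ?_⟩
  obtain ⟨k, hk, c, hc, hcV⟩ := h j hj
  rw [hcV V hV, hcV V' hV']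
  have hk' := h' k hk
  rcases hc.lt_or_gt with hc | hc
  · have e : ∀ x : ℝ, 0 < c * x ↔ x < 0 := fun x => by
      rw [← neg_mul_neg, mul_pos_iff_of_pos_left (neg_pos.2 hc), neg_pos]
    rw [e, e]
    have h1 := hVI k hk
    have h2 := hVI' k hk
    constructor
    · intro h3
      exact lt_of_le_of_ne (not_lt.1 fun h4 => lt_asymm h3 (hk'.2 h4)) h2
    · intro h3
      exact lt_of_le_of_ne (not_lt.1 fun h4 => lt_asymm h3 (hk'.1 h4)) h1
  · rwa [mul_pos_iff_of_pos_left hc, mul_pos_iff_of_pos_left hc]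

/-- A small move keeps the sign pattern. -/
theorem exists_pos_signs_add_smul {V : E} (hV : ∀ i ∈ I, f i V ≠ 0) (U : E) :
    ∃ ε : ℝ, 0 < ε ∧ ∀ i ∈ I, f i (V + ε • U) ≠ 0 ∧ (0 < f i (V + ε • U) ↔ 0 < f i V) := by
  have hev : ∀ᶠ ε : ℝ in nhds 0,
      ∀ i ∈ I, f i (V + ε • U) ≠ 0 ∧ (0 < f i (V + ε • U) ↔ 0 < f i V) := by
    rw [Filter.eventually_all_finset]
    intro i hi
    have hc : Filter.Tendsto (fun ε : ℝ => f i (V + ε • U)) (nhds 0) (nhds (f i V)) := by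
      have : Continuous fun ε : ℝ => f i V + ε * f i U := by fun_prop
      simpa using this.tendsto 0
    rcases (hV i hi).lt_or_gt with h | h
    · filter_upwards [hc.eventually_lt_const h] with ε hε
      exact ⟨hε.ne, iff_of_false hε.not_gt h.not_gt⟩
    · filter_upwards [hc.eventually_const_lt h] with ε hε
      exact ⟨hε.ne', iff_of_true hε h⟩
  have h1 : ∀ᶠ ε : ℝ in nhdsWithin 0 (Set.Ioi 0), 0 < ε := self_mem_nhdsWithin
  exact (h1.and (hev.filter_mono nhdsWithin_le_nhds)).exists

/-- The patterns realized on the part of `W` where `f i` has the same sign as `c`. -/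
def sidePatterns (f : ι → E →ₗ[ℝ] ℝ) (W : Submodule ℝ E) (I : Finset ι) (i : ι) (c : ℝ) :
    Set (Finset ι) :=
  (fun V => {j ∈ I | 0 < f j V}) '' {V | V ∈ W ∧ (∀ j ∈ I, f j V ≠ 0) ∧ 0 < c * f i V}

theorem sidePatterns_subset (i : ι) (c : ℝ) : sidePatterns f W I i c ⊆ signPatterns f W I := by
  rintro _ ⟨V, hV, rfl⟩
  exact ⟨V, ⟨hV.1, hV.2.1⟩, rfl⟩

theorem mem_sidePatterns_of_eq_zero {i : ι} {c : ℝ} (hc : c ≠ 0) (hi : ∃ V ∈ W, f i V ≠ 0) {V : E}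
    (hVW : V ∈ W) (hV : ∀ j ∈ I, f j V ≠ 0) (h0 : f i V = 0) :
    ({j ∈ I | 0 < f j V} : Finset ι) ∈ sidePatterns f W I i c := by
  obtain ⟨U, hUW, hU⟩ := hi
  obtain ⟨ε, hε, h⟩ := exists_pos_signs_add_smul hV ((c * f i U) • U)
  -- This direction raises `c * f i` from `0` to `ε * (c * f i U) ^ 2 > 0`.
  refine ⟨V + ε • (c * f i U) • U, ⟨?_, fun j hj => (h j hj).1, ?_⟩, ?_⟩
  · exact W.add_mem hVW (W.smul_mem _ (W.smul_mem _ hUW))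
  · simp only [map_add, map_smul, h0, smul_eq_mul, zero_add]
    have : 0 < ε * (c * f i U) ^ 2 := by positivity
    linarith
  · exact filter_pos_eq_iff.2 fun j hj => (h j hj).2

theorem sidePatterns_union {i : ι} (hi : ∃ V ∈ W, f i V ≠ 0) :
    sidePatterns f W I i (-1) ∪ sidePatterns f W I i 1 = signPatterns f W I := by
  refine (Set.union_subset (sidePatterns_subset _ _) (sidePatterns_subset _ _)).antisymm ?_
  rintro _ ⟨V, ⟨hVW, hV⟩, rfl⟩
  rcases lt_trichotomy (f i V) 0 with h | h | h
  · exact Or.inl ⟨V, ⟨hVW, hV, by linarith⟩, rfl⟩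
  · exact Or.inl (mem_sidePatterns_of_eq_zero (by norm_num) hi hVW hV h)
  · exact Or.inr ⟨V, ⟨hVW, hV, by linarith⟩, rfl⟩

/-- Cells are convex: a segment joining two points with the same pattern on opposite sides of `ker
(f i)` meets the kernel inside the cell. Conversely, a point of the kernel can be pushed to either
side. -/
theorem sidePatterns_inter {i : ι} (hi : ∃ V ∈ W, f i V ≠ 0) :
    sidePatterns f W I i (-1) ∩ sidePatterns f W I i 1 =
      signPatterns f (W ⊓ LinearMap.ker (f i)) I := by
  ext T
  constructor
  · rintro ⟨⟨V, ⟨hVW, hV, hVi⟩, rfl⟩, ⟨U, ⟨hUW, hU, hUi⟩, hUV⟩⟩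
    have hs := filter_pos_eq_iff.1 hUV
    have hVi' : 0 < -f i V := by linarith
    have hUi' : 0 < f i U := by linarith
    have key : ∀ j ∈ I, f j (f i U • V + (-f i V) • U) ≠ 0 ∧
        (0 < f j (f i U • V + (-f i V) • U) ↔ 0 < f j V) := by
      intro j hj
      simp only [map_add, map_smul, smul_eq_mul]
      rcases (hV j hj).lt_or_gt with h | h
      · have h' : f j U < 0 :=
          lt_of_le_of_ne (not_lt.1 fun h4 => lt_asymm h ((hs j hj).1 h4)) (hU j hj)
        have := add_neg (mul_neg_of_pos_of_neg hUi' h) (mul_neg_of_pos_of_neg hVi' h')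
        exact ⟨this.ne, iff_of_false this.not_gt h.not_gt⟩
      · have := add_pos (mul_pos hUi' h) (mul_pos hVi' ((hs j hj).2 h))
        exact ⟨this.ne', iff_of_true this h⟩
    refine ⟨f i U • V + (-f i V) • U, ⟨⟨?_, ?_⟩, fun j hj => (key j hj).1⟩,
      filter_pos_eq_iff.2 fun j hj => (key j hj).2⟩
    · exact W.add_mem (W.smul_mem _ hVW) (W.smul_mem _ hUW)
    · simp only [SetLike.mem_coe, LinearMap.mem_ker, map_add, map_smul, smul_eq_mul]
      ring
  · rintro ⟨V, ⟨⟨hVW, hVi⟩, hV⟩, rfl⟩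
    exact ⟨mem_sidePatterns_of_eq_zero (by norm_num) hi hVW hV hVi,
      mem_sidePatterns_of_eq_zero (by norm_num) hi hVW hV hVi⟩

variable [DecidableEq ι]

theorem signPatterns_insert (i : ι) :
    signPatterns f W (insert i I) =
      sidePatterns f W I i (-1) ∪ insert i '' sidePatterns f W I i 1 := by
  ext T
  constructor
  · rintro ⟨V, ⟨hVW, hV⟩, rfl⟩
    have hV' : ∀ j ∈ I, f j V ≠ 0 := fun j hj => hV j (Finset.mem_insert_of_mem hj)
    rcases (hV i (Finset.mem_insert_self _ _)).lt_or_gt with h | h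
    · refine Or.inl ⟨V, ⟨hVW, hV', by linarith⟩, ?_⟩
      simp only [Finset.filter_insert, if_neg h.not_gt]
    · refine Or.inr ⟨_, ⟨V, ⟨hVW, hV', by linarith⟩, rfl⟩, ?_⟩
      simp only [Finset.filter_insert, if_pos h]
  · rintro (⟨V, ⟨hVW, hV, h⟩, rfl⟩ | ⟨_, ⟨V, ⟨hVW, hV, h⟩, rfl⟩, rfl⟩)
    · have h : f i V < 0 := by linarith
      refine ⟨V, ⟨hVW, Finset.forall_mem_insert .. |>.2 ⟨h.ne, hV⟩⟩, ?_⟩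
      simp only [Finset.filter_insert, if_neg h.not_gt]
    · have h : 0 < f i V := by linarith
      refine ⟨V, ⟨hVW, Finset.forall_mem_insert .. |>.2 ⟨h.ne', hV⟩⟩, ?_⟩
      simp only [Finset.filter_insert, if_pos h]

/-- Deletion and restriction for sign patterns. -/
theorem ncard_signPatterns_insert {i : ι} (hiI : i ∉ I) (hi : ∃ V ∈ W, f i V ≠ 0) :
    (signPatterns f W (insert i I)).ncard =
      (signPatterns f W I).ncard + (signPatterns f (W ⊓ LinearMap.ker (f i)) I).ncard := by
  have hnot : ∀ c, ∀ T ∈ sidePatterns f W I i c, i ∉ T := by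
    rintro c _ ⟨V, -, rfl⟩ h
    exact hiI (Finset.mem_filter.1 h).1
  have hfin : ∀ c, (sidePatterns f W I i c).Finite := fun c =>
    signPatterns_finite.subset (sidePatterns_subset i c)
  rw [signPatterns_insert i, Set.ncard_union_eq _ (hfin _) ((hfin _).image _),
    Set.InjOn.ncard_image, ← sidePatterns_union hi, ← sidePatterns_inter hi,
    Set.ncard_union_add_ncard_inter _ _ (hfin _) (hfin _)]
  · intro T hT T' hT' h
    have := congrArg (Finset.erase · i) h
    simpa [Finset.erase_insert (hnot _ _ hT), Finset.erase_insert (hnot _ _ hT')] using this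
  · rw [Set.disjoint_left]
    rintro T hT ⟨T', -, rfl⟩
    exact hnot _ _ hT (Finset.mem_insert_self _ _)

/-- If `f i` vanishes on all of `W`, every point is a tie and the left side is zero. -/
theorem ncard_signPatterns_insert_le {i : ι} (hiI : i ∉ I) :
    (signPatterns f W (insert i I)).ncard ≤
      (signPatterns f W I).ncard + (signPatterns f (W ⊓ LinearMap.ker (f i)) I).ncard := by
  by_cases hi : ∃ V ∈ W, f i V ≠ 0
  · exact (ncard_signPatterns_insert hiI hi).le
  · push Not at hi
    simp [signPatterns_eq_empty (Finset.mem_insert_self i I) hi]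

theorem finrank_inf_ker_lt [FiniteDimensional ℝ E] {g : E →ₗ[ℝ] ℝ} (hg : ∃ V ∈ W, g V ≠ 0) :
    Module.finrank ℝ ↥(W ⊓ LinearMap.ker g) < Module.finrank ℝ W := by
  refine Submodule.finrank_lt_finrank_of_lt (lt_of_le_of_ne inf_le_left fun h => ?_)
  obtain ⟨V, hV, hgV⟩ := hg
  rw [← h] at hV
  exact hgV hV.2

theorem ncard_signPatterns_le_two [FiniteDimensional ℝ E] (hW : Module.finrank ℝ W ≤ 1)
    (hI : I.Nonempty) : (signPatterns f W I).ncard ≤ 2 := by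
  induction hI using Finset.Nonempty.cons_induction with
  | singleton i =>
    have := ncard_signPatterns_insert_le (f := f) (W := W) (Finset.notMem_empty i)
    simpa [ncard_signPatterns_empty] using this
  | cons i I hiI hI ih =>
    rw [Finset.cons_eq_insert]
    by_cases hi : ∃ V ∈ W, f i V ≠ 0
    · obtain ⟨k, hk⟩ := hI
      have h0 : W ⊓ LinearMap.ker (f i) = ⊥ := by
        rw [← Submodule.finrank_eq_zero (R := ℝ)]
        have := finrank_inf_ker_lt hi
        omega
      have h1 : signPatterns f (W ⊓ LinearMap.ker (f i)) I = ∅ :=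
        signPatterns_eq_empty hk (by simp [h0])
      rw [ncard_signPatterns_insert hiI hi, h1]
      simpa using ih
    · push Not at hi
      simp [signPatterns_eq_empty (Finset.mem_insert_self i I) hi]

/-- Each further line restricts the others to a space of dimension at most one, so it adds at most
two sectors. -/
theorem ncard_signPatterns_le_two_mul_card [FiniteDimensional ℝ E] (hW : Module.finrank ℝ W ≤ 2)
    (hI : I.Nonempty) : (signPatterns f W I).ncard ≤ 2 * I.card := by
  induction hI using Finset.Nonempty.cons_induction with
  | singleton i =>
    have := ncard_signPatterns_insert_le (f := f) (W := W) (Finset.notMem_empty i)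
    simpa [ncard_signPatterns_empty] using this
  | cons i I hiI hI ih =>
    rw [Finset.cons_eq_insert]
    by_cases hi : ∃ V ∈ W, f i V ≠ 0
    · have h0 := finrank_inf_ker_lt hi
      have h1 : (signPatterns f (W ⊓ LinearMap.ker (f i)) I).ncard ≤ 2 :=
        ncard_signPatterns_le_two (by omega) hI
      rw [ncard_signPatterns_insert hiI hi, Finset.card_insert_of_notMem hiI]
      omega
    · push Not at hi
      simp [signPatterns_eq_empty (Finset.mem_insert_self i I) hi]

theorem two_le_ncard_signPatterns (h : ∀ i ∈ I, ∃ V ∈ W, f i V ≠ 0) (hI : I.Nonempty) :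
    2 ≤ (signPatterns f W I).ncard := by
  induction hI using Finset.Nonempty.cons_induction with
  | singleton i =>
    have := ncard_signPatterns_insert (Finset.notMem_empty i) (h i (by simp))
    rw [insert_empty_eq, ncard_signPatterns_empty, ncard_signPatterns_empty] at this
    exact this.ge
  | cons i I hiI hI ih =>
    rw [Finset.cons_eq_insert, ncard_signPatterns_insert hiI (h i (by simp))]
    exact (ih fun j hj => h j (by simp [hj])).trans (Nat.le_add_right _ _)

/-- The second hypothesis says that no two kernels coincide on `W`, so each further functional adds
at least two cells. -/
theorem two_mul_card_le_ncard_signPatterns (h : ∀ i ∈ I, ∃ V ∈ W, f i V ≠ 0)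
    (h' : ∀ i ∈ I, ∀ j ∈ I, i ≠ j → ∃ V ∈ W ⊓ LinearMap.ker (f i), f j V ≠ 0) :
    2 * I.card ≤ (signPatterns f W I).ncard := by
  induction I using Finset.induction_on with
  | empty => simp
  | insert i I hiI ih =>
    have h1 := ih (fun j hj => h j (by simp [hj]))
      (fun j hj k hk => h' j (by simp [hj]) k (by simp [hk]))
    rcases I.eq_empty_or_nonempty with rfl | hI
    · simpa using two_le_ncard_signPatterns h (Finset.insert_nonempty _ _)
    rw [ncard_signPatterns_insert hiI (h i (by simp)), Finset.card_insert_of_notMem hiI]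
    have h2 : 2 ≤ (signPatterns f (W ⊓ LinearMap.ker (f i)) I).ncard :=
      two_le_ncard_signPatterns
        (fun j hj => h' i (by simp) j (by simp [hj]) fun hij => hiI (hij ▸ hj)) hI
    omega

end SignPatterns

/-! ### Bisector arrangements of points and the upper bound. -/

section Points

variable {E : Type*} [NormedAddCommGroup E] [InnerProductSpace ℝ E]

/-- The functional comparing the distances to the points numbered `k.1` and `k.2`. -/
noncomputable def comparison (P : ℕ → E) (k : ℕ × ℕ) : E →ₗ[ℝ] ℝ :=
  innerₗ E (P k.1 - P k.2)

theorem comparison_apply (P : ℕ → E) (k : ℕ × ℕ) (V : E) :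
    comparison P k V = inner ℝ (P k.1 - P k.2) V := rfl

/-- The pairs `(i, j)` with `i < j < n`. -/
def orderedPairs : ℕ → Finset (ℕ × ℕ)
  | 0 => ∅
  | n + 1 => orderedPairs n ∪ (Finset.range n).image (·, n)

theorem mem_orderedPairs {n : ℕ} {k : ℕ × ℕ} :
    k ∈ orderedPairs n ↔ k.1 < k.2 ∧ k.2 < n := by
  induction n with
  | zero => simp [orderedPairs]
  | succ n ih =>
    obtain ⟨i, j⟩ := k
    simp only [orderedPairs, Finset.mem_union, ih, Finset.mem_image, Finset.mem_range,
      Prod.mk.injEq]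
    constructor
    · rintro (h | ⟨a, h, rfl, rfl⟩) <;> omega
    · rintro ⟨h, h'⟩
      by_cases hj : j = n
      · exact Or.inr ⟨i, by omega, rfl, hj.symm⟩
      · exact Or.inl (by omega)

theorem two_mul_card_orderedPairs (n : ℕ) : 2 * ((orderedPairs n).card : ℚ) = n * (n - 1) := by
  induction n with
  | zero => simp [orderedPairs]
  | succ n ih =>
    rw [orderedPairs, Finset.card_union_of_disjoint, Finset.card_image_of_injective,
      Finset.card_range]
    · push_cast
      linarith
    · exact Prod.mk_left_injective n
    · rw [Finset.disjoint_left]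
      intro k hk hk'
      obtain ⟨a, -, rfl⟩ := Finset.mem_image.1 hk'
      exact lt_irrefl _ (mem_orderedPairs.1 hk).2

variable {P : ℕ → E}

/-- On this bisector `P a` and `P b` have equal inner product with `V`, so `(c, b)` may be replaced
by `(c, a)`, which is an old pair up to orientation. The pair `(a, b)` itself vanishes there and
must be excluded. -/
theorem ncard_signPatterns_on_bisector {a b : ℕ} (hab : a < b) {A : Finset ℕ}
    (hA : A ⊆ Finset.range b) (haA : a ∉ A) :
    (signPatterns (comparison P) (⊤ ⊓ LinearMap.ker (comparison P (a, b)))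
      (orderedPairs b ∪ A.image (·, b))).ncard =
    (signPatterns (comparison P) (⊤ ⊓ LinearMap.ker (comparison P (a, b)))
      (orderedPairs b)).ncard := by
  refine ncard_signPatterns_eq_of_proportional Finset.subset_union_left fun k hk => ?_
  rcases Finset.mem_union.1 hk with hk | hk
  · exact ⟨k, hk, 1, one_ne_zero, fun V _ => (one_mul _).symm⟩
  obtain ⟨c, hc, rfl⟩ := Finset.mem_image.1 hk
  have hcb := Finset.mem_range.1 (hA hc)
  have hV : ∀ V ∈ ⊤ ⊓ LinearMap.ker (comparison P (a, b)), inner ℝ (P a) V = inner ℝ (P b) V := by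
    intro V hV
    have := LinearMap.mem_ker.1 hV.2
    rw [comparison_apply, inner_sub_left] at this
    linarith
  rcases lt_trichotomy c a with h | h | h
  · refine ⟨(c, a), mem_orderedPairs.2 ⟨h, hab⟩, 1, one_ne_zero, fun V hVK => ?_⟩
    simp only [comparison_apply, inner_sub_left, hV V hVK, one_mul]
  · exact absurd (h ▸ hc) haA
  · refine ⟨(a, c), mem_orderedPairs.2 ⟨h, hcb⟩, -1, by norm_num, fun V hVK => ?_⟩
    simp only [comparison_apply, inner_sub_left, hV V hVK]
    ring

theorem exists_comparison_ne_zero {k : ℕ × ℕ} (h : P k.1 ≠ P k.2) :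
    ∃ V ∈ (⊤ : Submodule ℝ E), comparison P k V ≠ 0 :=
  ⟨P k.1 - P k.2, trivial, by
    rw [comparison_apply]
    exact inner_self_ne_zero.2 (sub_ne_zero.2 h)⟩

/-- Adding a new point: every old point contributes the patterns of the old points seen from
the bisector of the two points. -/
theorem ncard_signPatterns_orderedPairs_succ {b : ℕ} (hP : ∀ a < b, P a ≠ P b) :
    (signPatterns (comparison P) ⊤ (orderedPairs (b + 1))).ncard =
      (signPatterns (comparison P) ⊤ (orderedPairs b)).ncard +
      ∑ a ∈ Finset.range b, (signPatterns (comparison P)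
        (⊤ ⊓ LinearMap.ker (comparison P (a, b))) (orderedPairs b)).ncard := by
  -- The pairs `(a, b)` are inserted one at a time; those inserted earlier do not affect the count
  -- on the current bisector.
  have key : ∀ A ⊆ Finset.range b,
      (signPatterns (comparison P) ⊤ (orderedPairs b ∪ A.image (·, b))).ncard =
      (signPatterns (comparison P) ⊤ (orderedPairs b)).ncard +
      ∑ a ∈ A, (signPatterns (comparison P)
        (⊤ ⊓ LinearMap.ker (comparison P (a, b))) (orderedPairs b)).ncard := by
    intro A
    induction A using Finset.induction_on with
    | empty => simp
    | insert a A haA ih =>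
      intro hA
      have hab := Finset.mem_range.1 (hA (Finset.mem_insert_self a A))
      have hA' := (Finset.subset_insert a A).trans hA
      have hnot : (a, b) ∉ orderedPairs b ∪ A.image (·, b) := by
        simp only [Finset.mem_union, mem_orderedPairs, lt_irrefl, and_false, false_or,
          Finset.mem_image, Prod.mk.injEq, and_true, exists_eq_right]
        exact haA
      rw [Finset.image_insert, Finset.union_insert, ncard_signPatterns_insert hnot
        (exists_comparison_ne_zero (hP a hab)), ih hA', ncard_signPatterns_on_bisector hab hA' haA,
        Finset.sum_insert haA]
      ring
  exact key _ subset_rfl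

theorem ncard_signPatterns_two (h : P 0 ≠ P 1) :
    (signPatterns (comparison P) ⊤ (orderedPairs 2)).ncard = 2 := by
  have h1 : orderedPairs 1 = ∅ := by simp [orderedPairs]
  rw [ncard_signPatterns_orderedPairs_succ (by simpa using h), h1]
  simp [ncard_signPatterns_empty]

theorem ncard_signPatterns_le (hE : Module.finrank ℝ E = 3) {n : ℕ} (hn : 2 ≤ n)
    (hP : Set.InjOn P (Set.Iio n)) :
    ((signPatterns (comparison P) ⊤ (orderedPairs n)).ncard : ℚ) ≤
      (3 * (n : ℚ) ^ 4 - 10 * (n : ℚ) ^ 3 + 9 * (n : ℚ) ^ 2 - 2 * (n : ℚ) + 24) / 12 := by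
  have : FiniteDimensional ℝ E := Module.finite_of_finrank_pos (by omega)
  induction n, hn using Nat.le_induction with
  | base =>
    rw [ncard_signPatterns_two (hP.ne (by simp) (by simp) zero_ne_one)]
    norm_num
  | succ b hb ih =>
    have hne : ∀ a < b, P a ≠ P b := fun a ha =>
      hP.ne (Set.mem_Iio.2 (by omega)) (Set.mem_Iio.2 (by omega)) ha.ne
    have hle : ∀ a ∈ Finset.range b, (signPatterns (comparison P)
        (⊤ ⊓ LinearMap.ker (comparison P (a, b))) (orderedPairs b)).ncard ≤
          2 * (orderedPairs b).card := by
      intro a ha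
      have h1 := finrank_inf_ker_lt (exists_comparison_ne_zero (k := (a, b)) (hne a (Finset.mem_range.1 ha)))
      rw [finrank_top, hE] at h1
      exact ncard_signPatterns_le_two_mul_card (by omega)
        ⟨(0, 1), mem_orderedPairs.2 ⟨zero_lt_one, hb⟩⟩
    have hsum : ((∑ a ∈ Finset.range b, (signPatterns (comparison P)
        (⊤ ⊓ LinearMap.ker (comparison P (a, b))) (orderedPairs b)).ncard : ℕ) : ℚ) ≤
          b * (2 * (orderedPairs b).card) := by
      have := Finset.sum_le_card_nsmul _ _ _ hle
      rw [Finset.card_range, smul_eq_mul] at this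
      exact_mod_cast this
    have hih := ih (hP.mono (Set.Iio_subset_Iio (Nat.le_succ b)))
    rw [ncard_signPatterns_orderedPairs_succ hne]
    rw [two_mul_card_orderedPairs] at hsum
    push_cast at hsum ⊢
    linarith

/-! ### Generic points and the lower bound. -/

/-- No difference of a new point and an old one lies in a plane spanned by two differences of
old points. -/
def GenericUpTo (P : ℕ → E) (n : ℕ) : Prop :=
  ∀ b < n, ∀ a < b, ∀ i < b, ∀ j < b, ∀ k < b, ∀ l < b,
    P a - P b ∉ Submodule.span ℝ {P i - P j, P k - P l}

theorem GenericUpTo.mono {m n : ℕ} (h : GenericUpTo P n) (hmn : m ≤ n) : GenericUpTo P m :=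
  fun b hb => h b (hb.trans_le hmn)

/-- Coinciding indices are allowed in `GenericUpTo`; here they make the span zero. -/
theorem GenericUpTo.ne {n : ℕ} (h : GenericUpTo P n) {a b : ℕ} (hab : a < b) (hb : b < n) :
    P a ≠ P b := fun he =>
  h b hb a hab a hab a hab a hab a hab (by rw [he, sub_self]; exact zero_mem _)

theorem GenericUpTo.injOn {n : ℕ} (h : GenericUpTo P n) : Set.InjOn P (Set.Iio n) := by
  intro a ha b hb hab
  rcases lt_trichotomy a b with h1 | h1 | h1
  · exact absurd hab (h.ne h1 hb)
  · exact h1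
  · exact absurd hab.symm (h.ne h1 ha)

/-- If the larger indices differ, the difference with the newer point would be a multiple of an old
one. If they agree, subtraction gives `P k - P i = (c - 1) • (P i - P j)`, again contradicting
genericity. -/
theorem GenericUpTo.not_proportional {n : ℕ} (h : GenericUpTo P n) {p q : ℕ × ℕ}
    (hp : p ∈ orderedPairs n) (hq : q ∈ orderedPairs n) (hpq : p ≠ q) (c : ℝ) :
    P q.1 - P q.2 ≠ c • (P p.1 - P p.2) := by
  obtain ⟨i, j⟩ := p
  obtain ⟨k, l⟩ := q
  obtain ⟨hij, hj⟩ := mem_orderedPairs.1 hp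
  obtain ⟨hkl, hl⟩ := mem_orderedPairs.1 hq
  simp only at hij hj hkl hl ⊢
  intro he
  have hc : c ≠ 0 := by
    rintro rfl
    exact h.ne hkl hl (sub_eq_zero.1 (by simpa using he))
  rcases lt_trichotomy j l with hjl | rfl | hjl
  · refine h l hl k hkl i (hij.trans hjl) j hjl i (hij.trans hjl) j hjl ?_
    rw [he]
    exact Submodule.smul_mem _ _ (Submodule.subset_span (by simp))
  · have hik : i ≠ k := fun hik => hpq (by rw [hik])
    have h1 : P k - P i = (c - 1) • (P i - P j) := by
      rw [sub_smul, one_smul, ← he]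
      abel
    have hc1 : c - 1 ≠ 0 := by
      intro h0
      rw [h0, zero_smul, sub_eq_zero] at h1
      exact hik (h.injOn (hij.trans hj) (hkl.trans hj) h1.symm)
    refine h j hj i hij k hkl i hij k hkl i hij ?_
    rw [← inv_smul_smul₀ hc1 (P i - P j), ← h1]
    exact Submodule.smul_mem _ _ (Submodule.subset_span (by simp))
  · refine h j hj i hij k (hkl.trans hjl) l hjl k (hkl.trans hjl) l hjl ?_
    rw [← inv_smul_smul₀ hc (P i - P j), ← he]
    exact Submodule.smul_mem _ _ (Submodule.subset_span (by simp))

theorem mem_span_pair_of_inner_eq_zero {u v w : E}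
    (h : ∀ V, inner ℝ u V = 0 → inner ℝ v V = 0 → inner ℝ w V = 0) :
    w ∈ Submodule.span ℝ {u, v} := by
  have : FiniteDimensional ℝ (Submodule.span ℝ {u, v}) :=
    FiniteDimensional.span_of_finite ℝ (Set.toFinite _)
  rw [← Submodule.orthogonal_orthogonal (Submodule.span ℝ {u, v}), Submodule.mem_orthogonal']
  intro V hV
  rw [Submodule.mem_orthogonal] at hV
  exact h V (hV u (Submodule.subset_span (by simp))) (hV v (Submodule.subset_span (by simp)))

theorem GenericUpTo.le_ncard_signPatterns_bisector {b : ℕ} (h : GenericUpTo P (b + 1)) {a : ℕ}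
    (hab : a < b) : 2 * (orderedPairs b).card ≤ (signPatterns (comparison P)
        (⊤ ⊓ LinearMap.ker (comparison P (a, b))) (orderedPairs b)).ncard := by
  have hb := h.mono (Nat.le_succ b)
  -- In a relation with old differences, genericity kills the coefficient of `P a - P b`.
  have hspan : ∀ i < b, ∀ j < b, ∀ k < b, ∀ l < b, ∀ c d e : ℝ,
      c • (P a - P b) + d • (P i - P j) = e • (P k - P l) → c = 0 := by
    intro i hi j hj k hk l hl c d e he
    by_contra hc
    refine h b (Nat.lt_succ_self b) a hab i hi j hj k hk l hl ?_
    rw [Submodule.mem_span_pair]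
    refine ⟨c⁻¹ * -d, c⁻¹ * e, ?_⟩
    rw [mul_smul, mul_smul, ← smul_add, ← he, neg_smul, add_comm, add_neg_cancel_right,
      inv_smul_smul₀ hc]
  refine two_mul_card_le_ncard_signPatterns ?_ ?_
  · rintro ⟨k, l⟩ hkl
    by_contra! hcon
    obtain ⟨hkl, hl⟩ := mem_orderedPairs.1 hkl
    have hmem : P k - P l ∈ Submodule.span ℝ {P a - P b, P a - P b} :=
      mem_span_pair_of_inner_eq_zero fun V hV _ => hcon V ⟨trivial, hV⟩
    rw [Set.pair_eq_singleton, Submodule.mem_span_singleton] at hmem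
    obtain ⟨c, hc⟩ := hmem
    have h0 := hspan k (hkl.trans hl) k (hkl.trans hl) k (hkl.trans hl) l hl c 0 1
      (by rw [hc]; simp)
    rw [h0, zero_smul] at hc
    exact hb.ne hkl hl (sub_eq_zero.1 hc.symm)
  · rintro ⟨i, j⟩ hij ⟨k, l⟩ hkl hne
    by_contra! hcon
    have hmem : P k - P l ∈ Submodule.span ℝ {P a - P b, P i - P j} :=
      mem_span_pair_of_inner_eq_zero fun V hV hV' => hcon V ⟨⟨trivial, hV⟩, hV'⟩
    rw [Submodule.mem_span_pair] at hmem
    obtain ⟨c, d, hcd⟩ := hmem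
    obtain ⟨h1, h2⟩ := mem_orderedPairs.1 hij
    obtain ⟨h3, h4⟩ := mem_orderedPairs.1 hkl
    have h0 := hspan i (h1.trans h2) j h2 k (h3.trans h4) l h4 c d 1 (by rw [hcd, one_smul])
    rw [h0, zero_smul, zero_add] at hcd
    exact hb.not_proportional hij hkl hne d hcd.symm

theorem GenericUpTo.le_ncard_signPatterns {n : ℕ} (h : GenericUpTo P n) (hn : 2 ≤ n) :
    (3 * (n : ℚ) ^ 4 - 10 * (n : ℚ) ^ 3 + 9 * (n : ℚ) ^ 2 - 2 * (n : ℚ) + 24) / 12 ≤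
      ((signPatterns (comparison P) ⊤ (orderedPairs n)).ncard : ℚ) := by
  induction n, hn using Nat.le_induction with
  | base =>
    rw [ncard_signPatterns_two (h.ne zero_lt_one one_lt_two)]
    norm_num
  | succ b hb ih =>
    have hsum : (b : ℚ) * (2 * (orderedPairs b).card) ≤
        ((∑ a ∈ Finset.range b, (signPatterns (comparison P)
        (⊤ ⊓ LinearMap.ker (comparison P (a, b))) (orderedPairs b)).ncard : ℕ) : ℚ) := by
      have := Finset.card_nsmul_le_sum _ _ _ fun a ha =>
        h.le_ncard_signPatterns_bisector (Finset.mem_range.1 ha)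
      rw [Finset.card_range, smul_eq_mul] at this
      exact_mod_cast this
    have hih := ih (h.mono (Nat.le_succ b))
    rw [ncard_signPatterns_orderedPairs_succ fun a ha => h.ne ha (Nat.lt_succ_self b)]
    rw [two_mul_card_orderedPairs] at hsum
    push_cast at hsum ⊢
    linarith

end Points

/-! ### Existence of generic points on the sphere. -/

/-- A curve on the unit sphere that meets every plane in finitely many points. -/
noncomputable def sphereCurve (t : ℝ) : EuclideanSpace ℝ (Fin 3) :=
  -- Inverse stereographic projection of the parabola point `(t, t ^ 2)`.
  !₂[2 * t / (1 + t ^ 2 + t ^ 4), 2 * t ^ 2 / (1 + t ^ 2 + t ^ 4),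
    (t ^ 2 + t ^ 4 - 1) / (1 + t ^ 2 + t ^ 4)]

theorem norm_sphereCurve (t : ℝ) : ‖sphereCurve t‖ = 1 := by
  have hd : 1 + t ^ 2 + t ^ 4 ≠ 0 := by positivity
  rw [EuclideanSpace.norm_eq, Real.sqrt_eq_one]
  simp only [sphereCurve, Real.norm_eq_abs, sq_abs, Fin.sum_univ_three, Fin.isValue,
    Matrix.cons_val]
  field_simp
  ring

open Polynomial in
theorem finite_sphereCurve_inter_plane {m : EuclideanSpace ℝ (Fin 3)} (hm : m ≠ 0) (c : ℝ) :
    {t | inner ℝ m (sphereCurve t) = c}.Finite := by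
  let p : ℝ[X] := C (2 * m 0) * X + C (2 * m 1) * X ^ 2 + C (m 2) * (X ^ 2 + X ^ 4 - 1)
    - C c * (1 + X ^ 2 + X ^ 4)
  have heval : ∀ t, p.eval t = 2 * m 0 * t + 2 * m 1 * t ^ 2 + m 2 * (t ^ 2 + t ^ 4 - 1)
      - c * (1 + t ^ 2 + t ^ 4) := fun t => by simp [p]
  have hp : p ≠ 0 := by
    intro h0
    have h := fun t => (heval t).symm.trans (by rw [h0, eval_zero] : p.eval t = 0)
    -- Four values give a nonsingular linear system in `m 0`, `m 1`, `m 2`, `c`.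
    have e0 := h 0
    have e1 := h 1
    have e2 := h (-1)
    have e3 := h 2
    norm_num at e0 e1 e2 e3
    refine hm (PiLp.ext fun i => ?_)
    fin_cases i <;> simp <;> linarith
  refine (p.roots.toFinset.finite_toSet).subset fun t ht => ?_
  have hd : 1 + t ^ 2 + t ^ 4 ≠ 0 := by positivity
  rw [Finset.mem_coe, Multiset.mem_toFinset, mem_roots hp, IsRoot.def, heval]
  have ht : inner ℝ m (sphereCurve t) = c := ht
  simp only [sphereCurve, PiLp.inner_apply, RCLike.inner_apply, conj_trivial, Fin.sum_univ_three,
    Fin.isValue, Matrix.cons_val] at ht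
  rw [← ht]
  field_simp
  ring

/-- The span is proper, so it has a nonzero normal `m`, and membership puts the curve point on the
plane `⟪m, ·⟫ = ⟪m, x⟫`. -/
theorem finite_sub_sphereCurve_mem_span (x u v : EuclideanSpace ℝ (Fin 3)) :
    {t | x - sphereCurve t ∈ Submodule.span ℝ {u, v}}.Finite := by
  have hlt : Submodule.span ℝ {u, v} ≠ ⊤ := by
    intro h
    have h1 := finrank_span_le_card (R := ℝ) ({u, v} : Set (EuclideanSpace ℝ (Fin 3)))
    rw [h, finrank_top, finrank_euclideanSpace_fin, Set.toFinset_card] at h1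
    have h2 : Fintype.card ↑({u, v} : Set (EuclideanSpace ℝ (Fin 3))) ≤ 2 := by
      rw [← Nat.card_eq_fintype_card, Nat.card_coe_set_eq]
      exact (Set.ncard_insert_le u {v}).trans (by rw [Set.ncard_singleton])
    omega
  obtain ⟨m, hm, hm0⟩ := Submodule.exists_mem_ne_zero_of_ne_bot
    (mt (Submodule.orthogonal_eq_bot_iff).1 hlt)
  refine (finite_sphereCurve_inter_plane hm0 (inner ℝ m x)).subset fun t ht => ?_
  have := Submodule.inner_left_of_mem_orthogonal ht hm
  rw [inner_sub_right] at this
  exact (sub_eq_zero.1 this).symm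

theorem exists_genericUpTo (n : ℕ) : ∃ P : ℕ → EuclideanSpace ℝ (Fin 3),
    (∀ i, ‖P i‖ = 1) ∧ GenericUpTo P n := by
  induction n with
  | zero => exact ⟨fun _ => sphereCurve 0, fun _ => norm_sphereCurve 0, fun b hb => by simp at hb⟩
  | succ n ih =>
    obtain ⟨P, hP1, hP⟩ := ih
    have hfin : (⋃ s : Fin n × Fin n × Fin n × Fin n × Fin n,
        {t | P s.1 - sphereCurve t ∈ Submodule.span ℝ
          {P s.2.1 - P s.2.2.1, P s.2.2.2.1 - P s.2.2.2.2}}).Finite :=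
      Set.finite_iUnion fun s => finite_sub_sphereCurve_mem_span _ _ _
    obtain ⟨t, ht⟩ := hfin.exists_notMem
    have hold : ∀ i < n, Function.update P n (sphereCurve t) i = P i := fun i hi =>
      Function.update_of_ne hi.ne _ _
    refine ⟨Function.update P n (sphereCurve t), fun i => ?_, ?_⟩
    · by_cases hi : i = n
      · rw [hi, Function.update_self, norm_sphereCurve]
      · rw [Function.update_of_ne hi, hP1]
    · intro b hb a ha i hi j hj k hk l hl
      have hbn : b ≤ n := Nat.lt_succ_iff.1 hb
      rw [hold a (by omega), hold i (by omega), hold j (by omega), hold k (by omega),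
        hold l (by omega)]
      rcases hbn.lt_or_eq with hbn | rfl
      · rw [hold b hbn]
        exact hP b hbn a ha i hi j hj k hk l hl
      · rw [Function.update_self]
        intro hmem
        exact ht (Set.mem_iUnion.2 ⟨(⟨a, ha⟩, ⟨i, hi⟩, ⟨j, hj⟩, ⟨k, hk⟩, ⟨l, hl⟩), hmem⟩)

/-! ### From orderings on the sphere to sign patterns. -/

theorem geodesicDist_eq_arccos (p q : Sphere2) :
    geodesicDist p q = Real.arccos (inner ℝ (p : EuclideanSpace ℝ (Fin 3)) q) := by
  simp [geodesicDist, InnerProductGeometry.angle]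

theorem inner_mem_Icc (p q : Sphere2) :
    inner ℝ (p : EuclideanSpace ℝ (Fin 3)) q ∈ Set.Icc (-1 : ℝ) 1 := by
  have h := abs_real_inner_le_norm (p : EuclideanSpace ℝ (Fin 3)) q
  rw [norm_eq_of_mem_sphere, norm_eq_of_mem_sphere, one_mul] at h
  exact abs_le.1 h

theorem geodesicDist_lt_iff (V p q : Sphere2) : geodesicDist V p < geodesicDist V q ↔
    0 < inner ℝ ((p : EuclideanSpace ℝ (Fin 3)) - q) (V : EuclideanSpace ℝ (Fin 3)) := by
  rw [geodesicDist_eq_arccos, geodesicDist_eq_arccos,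
    Real.strictAntiOn_arccos.lt_iff_gt (inner_mem_Icc V p) (inner_mem_Icc V q),
    inner_sub_left, sub_pos, real_inner_comm, real_inner_comm (V : EuclideanSpace ℝ (Fin 3)) p]

theorem geodesicDist_eq_iff (V p q : Sphere2) : geodesicDist V p = geodesicDist V q ↔
    inner ℝ ((p : EuclideanSpace ℝ (Fin 3)) - q) (V : EuclideanSpace ℝ (Fin 3)) = 0 := by
  rw [geodesicDist_eq_arccos, geodesicDist_eq_arccos,
    Real.strictAntiOn_arccos.injOn.eq_iff (inner_mem_Icc V p) (inner_mem_Icc V q),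
    inner_sub_left, sub_eq_zero, real_inner_comm,
    real_inner_comm (V : EuclideanSpace ℝ (Fin 3)) q]

/-- For an enumerated set of points, orderings correspond to sign patterns of the comparisons. -/
theorem numOrderings_image {n : ℕ} (hn : 2 ≤ n) (Q : ℕ → Sphere2)
    (hQ : Set.InjOn Q (Set.Iio n)) (S : Finset Sphere2) (hS : ∀ p, p ∈ S ↔ ∃ i < n, Q i = p) :
    numOrderings S = (signPatterns
      (comparison fun i => (Q i : EuclideanSpace ℝ (Fin 3))) ⊤ (orderedPairs n)).ncard := by
  set P : ℕ → EuclideanSpace ℝ (Fin 3) := fun i => Q i with hPdef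
  have hpos : ∀ (V : Sphere2) (k : ℕ × ℕ),
      0 < comparison P k V ↔ geodesicDist V (Q k.1) < geodesicDist V (Q k.2) := fun V k => by
    rw [geodesicDist_lt_iff, comparison_apply]
  have hzero : ∀ (V : Sphere2) (k : ℕ × ℕ),
      comparison P k V = 0 ↔ geodesicDist V (Q k.1) = geodesicDist V (Q k.2) := fun V k => by
    rw [geodesicDist_eq_iff, comparison_apply]
  have hord : orderings S = vantageOrder S '' {V | TieFree S V} := rfl
  have hpat : signPatterns (comparison P) ⊤ (orderedPairs n) =
      (fun V : Sphere2 => {k ∈ orderedPairs n | 0 < comparison P k V}) '' {V | TieFree S V} := by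
    ext T
    constructor
    · rintro ⟨V, ⟨-, hV⟩, rfl⟩
      -- Patterns are realized by arbitrary vectors; a nonzero one can be scaled to the sphere. The
      -- pair `(0, 1)` rules out zero, as `n ≥ 2`.
      have hV0 : V ≠ 0 := by
        rintro rfl
        exact hV (0, 1) (mem_orderedPairs.2 ⟨zero_lt_one, hn⟩) (map_zero _)
      have hnorm : 0 < ‖V‖⁻¹ := inv_pos.2 (norm_pos_iff.2 hV0)
      refine ⟨⟨‖V‖⁻¹ • V, by simp [norm_smul, hV0]⟩, ?_, ?_⟩
      · rintro p hp q hq hpq heq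
        obtain ⟨i, hi, rfl⟩ := (hS p).1 hp
        obtain ⟨j, hj, rfl⟩ := (hS q).1 hq
        rcases lt_trichotomy i j with h | rfl | h
        · have := (hzero _ (i, j)).2 heq
          rw [map_smul, smul_eq_mul] at this
          exact mul_ne_zero hnorm.ne' (hV _ (mem_orderedPairs.2 ⟨h, hj⟩)) this
        · exact hpq rfl
        · have := (hzero _ (j, i)).2 heq.symm
          rw [map_smul, smul_eq_mul] at this
          exact mul_ne_zero hnorm.ne' (hV _ (mem_orderedPairs.2 ⟨h, hi⟩)) this
      · refine filter_pos_eq_iff.2 fun k _ => ?_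
        rw [map_smul, smul_eq_mul, mul_pos_iff_of_pos_left hnorm]
    · rintro ⟨V, hV, rfl⟩
      refine ⟨V, ⟨trivial, ?_⟩, rfl⟩
      intro k hk h0
      obtain ⟨h1, h2⟩ := mem_orderedPairs.1 hk
      exact hV _ ((hS _).2 ⟨k.1, h1.trans h2, rfl⟩) _ ((hS _).2 ⟨k.2, h2, rfl⟩)
        (hQ.ne (h1.trans h2) h2 h1.ne) ((hzero V k).1 h0)
  rw [numOrderings, hord, hpat]
  refine ncard_image_eq_ncard_image fun V hV V' hV' => ?_
  rw [filter_pos_eq_iff]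
  simp only [hpos]
  constructor
  · intro h k hk
    obtain ⟨h1, h2⟩ := mem_orderedPairs.1 hk
    exact iff_of_eq (congrFun (congrFun h ⟨Q k.1, (hS _).2 ⟨k.1, h1.trans h2, rfl⟩⟩)
      ⟨Q k.2, (hS _).2 ⟨k.2, h2, rfl⟩⟩)
  · intro h
    funext p q
    obtain ⟨p, hp⟩ := p
    obtain ⟨q, hq⟩ := q
    refine propext ?_
    change geodesicDist V p < geodesicDist V q ↔ geodesicDist V' p < geodesicDist V' q
    by_cases hpq : p = q
    · simp [hpq]
    have hne := hV p hp q hq hpq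
    have hne' := hV' p hp q hq hpq
    obtain ⟨i, hi, rfl⟩ := (hS p).1 hp
    obtain ⟨j, hj, rfl⟩ := (hS q).1 hq
    rcases lt_trichotomy i j with hij | rfl | hij
    · exact h (i, j) (mem_orderedPairs.2 ⟨hij, hj⟩)
    · exact absurd rfl hpq
    · have := h (j, i) (mem_orderedPairs.2 ⟨hij, hi⟩)
      -- Without ties, `<` is the negation of the reversed `<`, which is the comparison indexed by
      -- `(j, i)`.
      rw [← not_le, ← not_le, not_iff_not, hne.symm.le_iff_lt, hne'.symm.le_iff_lt]
      exact this

theorem exists_enumeration {α : Type*} {S : Finset α} {n : ℕ} (hn : 0 < n) (hS : S.card = n) :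
    ∃ Q : ℕ → α, Set.InjOn Q (Set.Iio n) ∧ ∀ p, p ∈ S ↔ ∃ i < n, Q i = p := by
  let e := S.equivFinOfCardEq hS
  -- Values at `i ≥ n` are irrelevant padding.
  refine ⟨fun i => if h : i < n then e.symm ⟨i, h⟩ else e.symm ⟨0, hn⟩, ?_, fun p => ?_⟩
  · intro i hi j hj hij
    have hi : i < n := hi
    have hj : j < n := hj
    simpa [hi, hj, Subtype.val_inj] using hij
  · constructor
    · intro hp
      exact ⟨e ⟨p, hp⟩, (e ⟨p, hp⟩).2, by simp⟩
    · rintro ⟨i, hi, rfl⟩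
      simp [hi]

theorem mainTheorem6 (n : ℕ) (hn : 1 < n) :
    IsGreatest {m : ℚ | ∃ S : Finset Sphere2, S.card = n ∧ m = (numOrderings S : ℚ)}
      ((3 * (n : ℚ) ^ 4 - 10 * (n : ℚ) ^ 3 + 9 * (n : ℚ) ^ 2 - 2 * (n : ℚ) + 24) / 12) := by
  have hE : Module.finrank ℝ (EuclideanSpace ℝ (Fin 3)) = 3 := finrank_euclideanSpace_fin
  constructor
  · obtain ⟨P, hP1, hP⟩ := exists_genericUpTo n
    let Q : ℕ → Sphere2 := fun i => ⟨P i, by simp [hP1]⟩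
    have hQ : Set.InjOn Q (Set.Iio n) := fun i hi j hj hij =>
      hP.injOn hi hj (congrArg Subtype.val hij)
    classical
    refine ⟨(Finset.range n).image Q, ?_, ?_⟩
    · rw [Finset.card_image_of_injOn (by simpa using hQ), Finset.card_range]
    · rw [numOrderings_image hn Q hQ _ (by simp)]
      exact (hP.le_ncard_signPatterns hn).antisymm (ncard_signPatterns_le hE hn hP.injOn)
  · rintro _ ⟨S, hS, rfl⟩
    obtain ⟨Q, hQ, hSQ⟩ := exists_enumeration (by omega) hS
    rw [numOrderings_image hn Q hQ S hSQ]
    exact ncard_signPatterns_le hE hn fun i hi j hj hij => hQ hi hj (Subtype.ext hij)
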